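/- Let $G$ be a countable amenable group and let $(F_n)$ be a (left) Følner sequence in $G$, i.e. a sequence of nonempty finite subsets with $|gF_n\,\triangle\,F_n|/|F_n|\to 0$ for every $g\in G$. For $c>1$ call a sequence $(E_n)$ of finite subsets of $G$ *$c$-bi-tempered* if for all $n$ $$\Big|\bigcup_{i<n}E_i^{-1}E_n\Big|\le c\,|E_n|\qquad\text{and}\qquad \Big|\bigcup_{i<n}E_nE_i^{-1}\Big|\le c\,|E_n| .$$ Assume that $(F_n)$ is *strongly tempered*: for every $c>1$ some tail $(F_n)_{n\ge m}$ is a $c$-bi-tempered sequence. For a measure-preserving action $(T_g)_{g\in G}$ of $G$ on a probability space $(X,\mathscr B,\mu)$, $f\in L^\infty_\mu(X)$ real-valued, $\alpha<\beta$ and an integer $N\ge 0$, put $\mathsf A_nf=\frac1{|F_n|}\sum_{g\in F_n}f\circ T_g$, and let $D_N=D_{(F_n),f,\alpha,\beta,N}$ be the set of $x\in X$ for which there are indices $n_1<n_2<\dots<n_{2N}$ with $\mathsf A_{n_i}f(x)\le\alpha$ for all odd $i$ and $\mathsf A_{n_i}f(x)\ge\beta$ for all even $i$. Then for any real $\alpha<\beta$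 and $S>0$ there exist $0<c_0<1$ and $c_1>0$ (depending only on $(F_n),\alpha,\beta,S$) such that for every measure-preserving action of $G$ on a probability space $(X,\mathscr B,\mu)$ and every real-valued $f\in L^\infty_\mu(X)$ with $\|f\|_\infty\le S$, $$\mu(D_N)\le c_1c_0^{N}\qquad\text{for all } N .$$ -/

import Mathlib

open MeasureTheory Filter
open scoped Pointwise ENNReal

/-- A sequence of nonempty finite subsets of `G` that is (left) Følner:
`|g F_n ∆ F_n| / |F_n| → 0` for every `g : G`. Sizes are measured by the counting measure on
the discrete measurable space `G`, and `G` acts on itself by left translation. -/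
def IsLeftFolnerSeq {G : Type*} [Group G] (F : ℕ → Finset G) : Prop :=
  letI : MeasurableSpace G := ⊤
  (∀ n, (F n).Nonempty) ∧
    IsFoelner G (Measure.count : Measure G) atTop (fun n => (F n : Set G))

/-- `|⋃_{i<n} F_i⁻¹ F_n| ≤ c |F_n|` for all `n`. -/
def IsLeftTempered {G : Type*} [Group G] [DecidableEq G] (c : ℝ) (F : ℕ → Finset G) : Prop :=
  ∀ n, (((Finset.range n).biUnion fun i => (F i)⁻¹ * F n).card : ℝ) ≤ c * ((F n).card : ℝ)

/-- `|⋃_{i<n} F_n F_i⁻¹| ≤ c |F_n|` for all `n`. -/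
def IsRightTempered {G : Type*} [Group G] [DecidableEq G] (c : ℝ) (F : ℕ → Finset G) : Prop :=
  ∀ n, (((Finset.range n).biUnion fun i => F n * (F i)⁻¹).card : ℝ) ≤ c * ((F n).card : ℝ)

def IsBiTempered {G : Type*} [Group G] [DecidableEq G] (c : ℝ) (F : ℕ → Finset G) : Prop :=
  IsLeftTempered c F ∧ IsRightTempered c F

/-- For every `c > 1` some tail `(F_m, F_{m+1}, …)`, as a sequence in its own right, is
`c`-bi-tempered. -/
def IsStronglyTempered {G : Type*} [Group G] [DecidableEq G] (F : ℕ → Finset G) : Prop :=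
  ∀ c : ℝ, 1 < c → ∃ m : ℕ, IsBiTempered c (fun n => F (m + n))

/-- The ergodic average `(1/|F|) ∑_{g ∈ F} f (g x)`. -/
noncomputable def ergodicAverage {G X : Type*} [Group G] [MulAction G X]
    (F : Finset G) (f : X → ℝ) (x : X) : ℝ :=
  ((F.card : ℝ))⁻¹ * ∑ g ∈ F, f (g • x)

/-- The real sequence `a` fluctuates (at least) `N` times across the gap `(α, β)`: there are
`n_1 < ⋯ < n_{2N}` with `a_{n_k} ≤ α` for odd `k` and `a_{n_k} ≥ β` for even `k`.
Here `n i` stands for `n_{i+1}`. -/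
def Fluctuates (a : ℕ → ℝ) (α β : ℝ) (N : ℕ) : Prop :=
  ∃ n : Fin (2 * N) → ℕ, StrictMono n ∧
    ∀ i : Fin (2 * N), (Odd ((i : ℕ) + 1) → a (n i) ≤ α) ∧ (Even ((i : ℕ) + 1) → β ≤ a (n i))

/-- The set `D_N` of points whose ergodic averages along `F` fluctuate at least `N` times. -/
def fluctuationSet {G X : Type*} [Group G] [MulAction G X]
    (F : ℕ → Finset G) (f : X → ℝ) (α β : ℝ) (N : ℕ) : Set X :=
  {x | Fluctuates (fun n => ergodicAverage (F n) f x) α β N}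

/-! The argument takes place on a single orbit. Put `φ y = f (y • x)`, so that averages of `f` at `g
• x` become averages of `φ` over tiles `E n * {g}`, and let `B` be the set of `g` in a large Følner
set for which `g • x` fluctuates often at scales at most `M`. The claim is that `B` is exponentially
sparse.

Start with `V = B`. Each point of `V` lies in a tile around some `g ∈ B` that still has many
fluctuations ahead. Low-average tiles at later scales yield an almost disjoint union `V'` that
contains most of `V` and on which `φ` averages at most about `α`. High-average tiles at still later
scales yield `U`, which contains most of `V'` and on which `φ` averages at least about `β`. Since
`φ` is bounded, passing from a low to a high average forces `U` to be larger than `V` by a fixed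
factor (`exists_card_growth`). A round uses a fixed number `2 * L` of fluctuations, and every set
produced stays inside `(⋃ i ≤ M, E i) * B`. The Følner property bounds that product by twice the
size of the Følner set, so `k` rounds bound the density of `B` by `2 * (1 + γ / 2)⁻ᵏ`; integration
over `x` turns density into measure.

The efficient covering (`exists_efficient_cover`) uses both halves of bi-temperedness. The left one
says that the centres of smaller tiles meeting a chosen union hardly outnumber the union itself, so
little is lost by discarding them. The right one says that moving the centre of a large tile within
a smaller tile hardly changes it, so a point of `V` can serve as centre in place of `g`. -/

/-! ### Covering by almost disjoint tiles. -/

/-- Double counting: a point `w` lies in `A * {h}` only if `h ∈ A⁻¹ * {w}`, which leaves at most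
`A.card` centres. -/
theorem sum_card_inter_le {G : Type*} [Group G] [DecidableEq G] (A B W : Finset G)
    (T : G → Finset G) (hT : ∀ h ∈ B, T h ⊆ A * {h}) :
    ∑ h ∈ B, (T h ∩ W).card ≤ W.card * A.card := by
  have h1 : ∀ h ∈ B, (T h ∩ W).card = ∑ w ∈ W, if w ∈ T h then 1 else 0 := by
    intro h _
    rw [Finset.inter_comm, ← Finset.filter_mem_eq_inter, Finset.card_filter]
  rw [Finset.sum_congr rfl h1, Finset.sum_comm, ← smul_eq_mul, ← Finset.sum_const]
  refine Finset.sum_le_sum fun w _ => ?_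
  rw [← Finset.card_filter]
  calc (B.filter fun h => w ∈ T h).card ≤ (A⁻¹ * {w}).card := by
        refine Finset.card_le_card fun h hh => ?_
        rw [Finset.mem_filter] at hh
        have := hT h hh.1 hh.2
        obtain ⟨a, ha, b, hb, rfl⟩ := Finset.mem_mul.1 this
        rw [Finset.mem_singleton.1 hb]
        exact Finset.mem_mul.2 ⟨a⁻¹, Finset.inv_mem_inv ha, a * h, Finset.mem_singleton_self _,
          inv_mul_cancel_left a h⟩
    _ = A.card := by rw [Finset.card_mul_singleton, Finset.card_inv]

/-- A greedy choice of almost disjoint tiles at a single scale. -/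
theorem exists_almost_disjoint_union {G : Type*} [Group G] [DecidableEq G] {A B : Finset G}
    {T : G → Finset G} {ψ : G → ℝ} {κ ε : ℝ} (hA : A.Nonempty) (hε' : ε ≤ 1 / 4)
    (hT : ∀ h ∈ B, T h ⊆ A * {h}) (hcard : ∀ h ∈ B, (1 - ε) * A.card ≤ (T h).card)
    (hψ : ∀ h ∈ B, ∀ T' ⊆ T h, (1 - 2 * ε) * A.card ≤ T'.card →
      -κ * T'.card ≤ ∑ y ∈ T', ψ y) :
    ∃ C ⊆ B, ε * B.card ≤ (C.biUnion T).card ∧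
      (1 - 2 * ε) * A.card * C.card ≤ (C.biUnion T).card ∧
      -κ * (C.biUnion T).card ≤ ∑ y ∈ C.biUnion T, ψ y := by
  classical
  have hA0 : (0 : ℝ) < A.card := by exact_mod_cast hA.card_pos
  -- A maximal `C` in this family works: a tile meeting the union in fewer than `ε * A.card` points
  -- could be added, as its new part still satisfies `hψ`. So every tile is hit substantially, and
  -- double counting bounds `B`.
  let P : Finset (Finset G) := B.powerset.filter fun C =>
      (1 - 2 * ε) * A.card * C.card ≤ (C.biUnion T).card ∧
      -κ * (C.biUnion T).card ≤ ∑ y ∈ C.biUnion T, ψ y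
  have hP : P.Nonempty := ⟨∅, by simp [P]⟩
  obtain ⟨C, hC, hmax⟩ := P.exists_max_image Finset.card hP
  simp only [P, Finset.mem_filter, Finset.mem_powerset] at hC
  refine ⟨C, hC.1, ?_, hC.2⟩
  set W := C.biUnion T with hW
  have key : ∀ h ∈ B, ε * A.card ≤ (T h ∩ W).card := by
    intro h hh
    by_cases hhC : h ∈ C
    · have : T h ⊆ W := Finset.subset_biUnion_of_mem T hhC
      rw [Finset.inter_eq_left.2 this]
      nlinarith [hcard h hh]
    · by_contra! hlt
      have hsd : (1 - 2 * ε) * A.card ≤ (T h \ W).card := by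
        have h1 : ((T h ∩ W).card : ℝ) + (T h \ W).card = (T h).card := by
          exact_mod_cast Finset.card_inter_add_card_sdiff (T h) W
        linarith [hcard h hh]
      have hsum := hψ h hh (T h \ W) Finset.sdiff_subset hsd
      have hU : (insert h C).biUnion T = W ∪ (T h \ W) := by
        rw [Finset.biUnion_insert, Finset.union_sdiff_self_eq_union, Finset.union_comm]
      have hdisj : Disjoint W (T h \ W) := Finset.disjoint_sdiff
      have hmem : insert h C ∈ P := by
        simp only [P, Finset.mem_filter, Finset.mem_powerset]
        refine ⟨Finset.insert_subset hh hC.1, ?_, ?_⟩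
        · rw [hU, Finset.card_union_of_disjoint hdisj, Finset.card_insert_of_notMem hhC]
          push_cast
          linarith [hC.2.1]
        · rw [hU, Finset.card_union_of_disjoint hdisj, Finset.sum_union hdisj]
          push_cast
          linarith [hC.2.2]
      have := hmax _ hmem
      rw [Finset.card_insert_of_notMem hhC] at this
      omega
  have h1 : ∑ h ∈ B, ε * (A.card : ℝ) ≤ ∑ h ∈ B, ((T h ∩ W).card : ℝ) := Finset.sum_le_sum key
  have h2 : ∑ h ∈ B, ((T h ∩ W).card : ℝ) ≤ W.card * A.card := by
    exact_mod_cast sum_card_inter_le A B W T hT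
  rw [Finset.sum_const, nsmul_eq_mul] at h1
  refine le_of_mul_le_mul_right ?_ hA0
  linarith

/-- The scales in `[n, n + d)` are used from the largest to the smallest. The set `Z` contains the
union `U` of the chosen tiles and the centres of all smaller tiles that meet `U`. -/
theorem exists_efficient_cover_aux {G : Type*} [Group G] [DecidableEq G] {E : ℕ → Finset G}
    {V : Finset G} {T : G → ℕ → Finset G} {Sc : G → Finset ℕ} {ψ : G → ℝ} {κ ε : ℝ}
    (hE : ∀ n, (E n).Nonempty) (h1 : 1 ∈ E 0) (hl : IsLeftTempered (1 + ε) E)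
    (hε : 0 < ε) (hε' : ε ≤ 1 / 4)
    (hT : ∀ h ∈ V, ∀ n ∈ Sc h, T h n ⊆ E n * {h})
    (hcard : ∀ h ∈ V, ∀ n ∈ Sc h, (1 - ε) * (E n).card ≤ (T h n).card)
    (hψ : ∀ h ∈ V, ∀ n ∈ Sc h, ∀ T' ⊆ T h n, (1 - 2 * ε) * (E n).card ≤ T'.card →
      -κ * T'.card ≤ ∑ y ∈ T', ψ y) (n d : ℕ) :
    ∃ U Z : Finset G, U ⊆ Z ∧ (Z.card : ℝ) ≤ (1 + 6 * ε) * U.card ∧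
      -κ * U.card ≤ ∑ y ∈ U, ψ y ∧
      (∀ y ∈ U, ∃ h ∈ V, ∃ m ∈ Sc h, y ∈ T h m) ∧
      (∀ h ∉ Z, ∀ i < n, Disjoint (E i * {h}) U) ∧
      ε * ∑ m ∈ Finset.Ico n (n + d), (((V \ Z).filter fun h => m ∈ Sc h).card : ℝ) ≤ U.card := by
  induction d generalizing n with
  | zero => exact ⟨∅, ∅, by simp⟩
  | succ d ih =>
    obtain ⟨U, Z, hUZ, hZ, hU, hUT, hdis, hsum⟩ := ih (n + 1)
    set B := (V \ Z).filter fun h => n ∈ Sc h with hB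
    have hBV : ∀ h ∈ B, h ∈ V ∧ h ∉ Z ∧ n ∈ Sc h := by
      intro h hh
      simp only [hB, Finset.mem_filter, Finset.mem_sdiff] at hh
      tauto
    obtain ⟨C, hCB, hW1, hW2, hW3⟩ := exists_almost_disjoint_union (A := E n) (B := B)
      (T := fun h => T h n) (ψ := ψ) (κ := κ) (hE n) hε'
      (fun h hh => hT h (hBV h hh).1 n (hBV h hh).2.2)
      (fun h hh => hcard h (hBV h hh).1 n (hBV h hh).2.2)
      (fun h hh => hψ h (hBV h hh).1 n (hBV h hh).2.2)
    set W := C.biUnion fun h => T h n with hW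
    -- `H * C` contains `W` and all centres of smaller tiles meeting `W`. Joining `E n` matters only
    -- at `n = 0`, where the union over `i < n` is empty; otherwise `1 ∈ E 0` already gives it.
    set H := E n ∪ (Finset.range n).biUnion fun i => (E i)⁻¹ * E n with hH
    have hWC : W ⊆ E n * C := by
      intro y hy
      obtain ⟨h, hh, hy⟩ := Finset.mem_biUnion.1 hy
      have hhB := hBV h (hCB hh)
      exact Finset.mul_subset_mul_left (Finset.singleton_subset_iff.2 hh) (hT h hhB.1 n hhB.2.2 hy)
    have hHcard : (H.card : ℝ) ≤ (1 + ε) * (E n).card := by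
      rcases Nat.eq_zero_or_pos n with rfl | hn
      · simp only [hH, Finset.range_zero, Finset.biUnion_empty, Finset.union_empty]
        nlinarith [(Nat.cast_nonneg (E 0).card : (0 : ℝ) ≤ _)]
      · have : H = (Finset.range n).biUnion fun i => (E i)⁻¹ * E n := by
          rw [hH, Finset.union_eq_right]
          intro y hy
          refine Finset.mem_biUnion.2 ⟨0, Finset.mem_range.2 hn, ?_⟩
          exact Finset.mem_mul.2 ⟨1, by simpa using h1, y, hy, one_mul y⟩
        rw [this]
        exact hl n
    have hUW : Disjoint U W := by
      rw [Finset.disjoint_right]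
      intro y hy
      obtain ⟨h, hh, hy⟩ := Finset.mem_biUnion.1 hy
      have hhB := hBV h (hCB hh)
      exact Finset.disjoint_left.1 (hdis h hhB.2.1 n (Nat.lt_succ_self n))
        (hT h hhB.1 n hhB.2.2 hy)
    have hZcard : ((Z ∪ H * C).card : ℝ) ≤ Z.card + H.card * C.card := by
      exact_mod_cast (Finset.card_union_le _ _).trans (Nat.add_le_add_left Finset.card_mul_le _)
    have hcU : ((U ∪ W).card : ℝ) = U.card + W.card := by
      exact_mod_cast Finset.card_union_of_disjoint hUW
    refine ⟨U ∪ W, Z ∪ H * C, ?_, ?_, ?_, ?_, ?_, ?_⟩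
    · exact Finset.union_subset_union hUZ
        (hWC.trans (Finset.mul_subset_mul_right Finset.subset_union_left))
    · have hHC : (H.card : ℝ) * C.card ≤ (1 + ε) * (E n).card * C.card :=
        mul_le_mul_of_nonneg_right hHcard (Nat.cast_nonneg _)
      have hnn : (0 : ℝ) ≤ (E n).card * C.card := by positivity
      -- The constant 6 comes from `(1 + ε) / (1 - 2 * ε) ≤ 1 + 6 * ε`, valid for `ε ≤ 1 / 4`.
      have : (1 + ε) * (E n).card * C.card ≤ (1 + 6 * ε) * W.card := by
        have h3 : (1 + 6 * ε) * ((1 - 2 * ε) * (E n).card * C.card) ≤ (1 + 6 * ε) * W.card :=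
          mul_le_mul_of_nonneg_left hW2 (by linarith)
        have h4 : (1 + ε) ≤ (1 + 6 * ε) * (1 - 2 * ε) := by nlinarith
        nlinarith
      rw [hcU]
      linarith
    · rw [hcU, Finset.sum_union hUW]
      linarith
    · intro y hy
      rcases Finset.mem_union.1 hy with hy | hy
      · exact hUT y hy
      · obtain ⟨h, hh, hy⟩ := Finset.mem_biUnion.1 hy
        have hhB := hBV h (hCB hh)
        exact ⟨h, hhB.1, n, hhB.2.2, hy⟩
    · intro h hh i hi
      rw [Finset.mem_union, not_or] at hh
      rw [Finset.disjoint_union_right]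
      refine ⟨hdis h hh.1 i (by omega), ?_⟩
      rw [Finset.disjoint_left]
      intro y hy hyW
      apply hh.2
      obtain ⟨a, ha, b, hb, hab⟩ := Finset.mem_mul.1 (hWC hyW)
      obtain ⟨e, he, k, hk, rfl⟩ := Finset.mem_mul.1 hy
      rw [Finset.mem_singleton.1 hk] at hab
      refine Finset.mem_mul.2 ⟨e⁻¹ * a, ?_, b, hb, by rw [mul_assoc, hab]; group⟩
      refine Finset.mem_union_right _ (Finset.mem_biUnion.2 ⟨i, Finset.mem_range.2 hi, ?_⟩)
      exact Finset.mul_mem_mul (Finset.inv_mem_inv he) ha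
    · rw [Finset.sum_eq_sum_Ico_succ_bot (by omega), hcU]
      have h3 : (((V \ (Z ∪ H * C)).filter fun h => n ∈ Sc h).card : ℝ) ≤ B.card := by
        exact_mod_cast Finset.card_le_card (Finset.filter_subset_filter _
          (Finset.sdiff_subset_sdiff subset_rfl Finset.subset_union_left))
      have h4 : ∑ m ∈ Finset.Ico (n + 1) (n + (d + 1)),
          (((V \ (Z ∪ H * C)).filter fun h => m ∈ Sc h).card : ℝ) ≤
          ∑ m ∈ Finset.Ico (n + 1) (n + 1 + d), (((V \ Z).filter fun h => m ∈ Sc h).card : ℝ) := by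
        rw [show n + 1 + d = n + (d + 1) by ring]
        refine Finset.sum_le_sum fun m _ => ?_
        exact_mod_cast Finset.card_le_card (Finset.filter_subset_filter _
          (Finset.sdiff_subset_sdiff subset_rfl Finset.subset_union_left))
      have h5 := mul_le_mul_of_nonneg_left h3 hε.le
      have h6 := mul_le_mul_of_nonneg_left h4 hε.le
      rw [mul_add]
      linarith

/-- Multi-scale covering: if every point of `V` carries at least `L ≥ ε⁻²` scales, then most of `V`
is covered by an almost disjoint union of tiles. -/
theorem exists_efficient_cover {G : Type*} [Group G] [DecidableEq G] {E : ℕ → Finset G}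
    {V : Finset G} {T : G → ℕ → Finset G} {Sc : G → Finset ℕ} {ψ : G → ℝ} {κ ε : ℝ} {M L : ℕ}
    (hE : ∀ n, (E n).Nonempty) (h1 : 1 ∈ E 0) (hl : IsLeftTempered (1 + ε) E)
    (hε : 0 < ε) (hε' : ε ≤ 1 / 4) (hL : 1 ≤ ε ^ 2 * L)
    (hM : ∀ h ∈ V, ∀ n ∈ Sc h, n ≤ M) (hSc : ∀ h ∈ V, L ≤ (Sc h).card)
    (hT : ∀ h ∈ V, ∀ n ∈ Sc h, T h n ⊆ E n * {h})
    (hcard : ∀ h ∈ V, ∀ n ∈ Sc h, (1 - ε) * (E n).card ≤ (T h n).card)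
    (hψ : ∀ h ∈ V, ∀ n ∈ Sc h, ∀ T' ⊆ T h n, (1 - 2 * ε) * (E n).card ≤ T'.card →
      -κ * T'.card ≤ ∑ y ∈ T', ψ y) :
    ∃ U : Finset G, ((V \ U).card : ℝ) ≤ 7 * ε * U.card ∧
      -κ * U.card ≤ ∑ y ∈ U, ψ y ∧ ∀ y ∈ U, ∃ h ∈ V, ∃ m ∈ Sc h, y ∈ T h m := by
  obtain ⟨U, Z, hUZ, hZ, hU, hUT, -, hsum⟩ :=
    exists_efficient_cover_aux hE h1 hl hε hε' hT hcard hψ 0 (M + 1)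
  refine ⟨U, ?_, hU, hUT⟩
  have h2 : (L : ℝ) * (V \ Z).card ≤
      ∑ m ∈ Finset.Ico 0 (0 + (M + 1)), (((V \ Z).filter fun h => m ∈ Sc h).card : ℝ) := by
    have : (V \ Z).card * L ≤ ∑ m ∈ Finset.Ico 0 (0 + (M + 1)),
        ((V \ Z).filter fun h => m ∈ Sc h).card := by
      simp only [Finset.card_filter]
      rw [Finset.sum_comm, ← smul_eq_mul, ← Finset.sum_const]
      refine Finset.sum_le_sum fun h hh => ?_
      have hhV := (Finset.mem_sdiff.1 hh).1
      rw [← Finset.card_filter]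
      refine (hSc h hhV).trans (Finset.card_le_card fun m hm => ?_)
      have := hM h hhV m hm
      simp only [Finset.mem_filter, Finset.mem_Ico]
      exact ⟨by omega, hm⟩
    rw [mul_comm]
    exact_mod_cast this
  -- A point outside `Z` was available at each of its `L` or more scales, so `ε * L * |V \ Z| ≤
  -- |U|`, and `ε ^ 2 * L ≥ 1` concludes.
  have h3 : ((V \ Z).card : ℝ) ≤ ε * U.card := by
    have h4 := mul_le_mul_of_nonneg_left h2 (sq_nonneg ε)
    have h5 := mul_le_mul_of_nonneg_left hsum hε.le
    have h6 := mul_le_mul_of_nonneg_right hL (Nat.cast_nonneg (α := ℝ) (V \ Z).card)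
    nlinarith
  have h4 : (V \ U).card ≤ (V \ Z).card + (Z \ U).card := by
    refine (Finset.card_le_card fun y hy => ?_).trans (Finset.card_union_le _ _)
    simp only [Finset.mem_union, Finset.mem_sdiff] at hy ⊢
    tauto
  have h5 : ((Z \ U).card : ℝ) = Z.card - U.card := by
    rw [Finset.card_sdiff_of_subset hUZ, Nat.cast_sub (Finset.card_le_card hUZ)]
  have h6 : ((V \ U).card : ℝ) ≤ (V \ Z).card + (Z \ U).card := by exact_mod_cast h4
  linarith

/-! ### Tiles with displaced centres. -/

/-- Writing `h = f * g` with `f ∈ E i`, both tiles lie in the translate by `h` of `⋃ i < n, E n * (E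
i)⁻¹`, whose size is at most `(1 + ε) * (E n).card`; inclusion-exclusion then forces a large
overlap. -/
theorem IsRightTempered.card_mul_singleton_inter {G : Type*} [Group G] [DecidableEq G] {ε : ℝ}
    {E : ℕ → Finset G} (h1 : 1 ∈ E 0) (hr : IsRightTempered (1 + ε) E) {i n : ℕ} (hi : i < n)
    {g h : G} (hh : h ∈ E i * {g}) :
    (1 - ε) * (E n).card ≤ ((E n * {h} ∩ (E n * {g})).card : ℝ) := by
  obtain ⟨f, hf, k, hk, rfl⟩ := Finset.mem_mul.1 hh
  obtain rfl := Finset.mem_singleton.1 hk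
  set D := (Finset.range n).biUnion fun i => E n * (E i)⁻¹ with hD
  have hA : E n * {f * k} ⊆ D * {f * k} := by
    refine Finset.mul_subset_mul_right fun y hy => ?_
    exact Finset.mem_biUnion.2 ⟨0, Finset.mem_range.2 (by omega),
      Finset.mem_mul.2 ⟨y, hy, 1, by simpa using h1, mul_one y⟩⟩
  have hB : E n * {k} ⊆ D * {f * k} := by
    intro y hy
    obtain ⟨a, ha, b, hb, rfl⟩ := Finset.mem_mul.1 hy
    rw [Finset.mem_singleton.1 hb]
    refine Finset.mem_mul.2 ⟨a * f⁻¹, ?_, f * k, Finset.mem_singleton_self _, by group⟩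
    exact Finset.mem_biUnion.2 ⟨i, Finset.mem_range.2 hi,
      Finset.mul_mem_mul ha (Finset.inv_mem_inv hf)⟩
  have hU : (E n * {f * k} ∪ E n * {k}).card ≤ D.card := by
    rw [← Finset.card_mul_singleton D (f * k)]
    exact Finset.card_le_card (Finset.union_subset hA hB)
  have hI := Finset.card_union_add_card_inter (E n * {f * k}) (E n * {k})
  rw [Finset.card_mul_singleton, Finset.card_mul_singleton] at hI
  have hU' : ((E n * {f * k} ∪ E n * {k}).card : ℝ) ≤ (1 + ε) * (E n).card :=
    (Nat.cast_le.2 hU).trans (hr n)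
  have hI' : ((E n * {f * k} ∪ E n * {k}).card : ℝ) + (E n * {f * k} ∩ (E n * {k})).card =
      (E n).card + (E n).card := by exact_mod_cast hI
  linarith

/-- Each `h ∈ V` lies in a small tile around `g h`, and the sums of `ψ` over the larger tiles
around `g h` at the scales `Sc h` are nonnegative. -/
theorem exists_cover_of_sum_nonneg {G : Type*} [Group G] [DecidableEq G] {E : ℕ → Finset G}
    {V : Finset G} {g : G → G} {i : G → ℕ} {Sc : G → Finset ℕ} {ψ : G → ℝ} {K ε : ℝ} {M L : ℕ}
    (hE : ∀ n, (E n).Nonempty) (h1 : 1 ∈ E 0) (ht : IsBiTempered (1 + ε) E)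
    (hε : 0 < ε) (hε' : ε ≤ 1 / 4) (hL : 1 ≤ ε ^ 2 * L) (hK : ∀ y, |ψ y| ≤ K)
    (hSc : ∀ h ∈ V, L ≤ (Sc h).card)
    (hg : ∀ h ∈ V, h ∈ E (i h) * {g h})
    (hs : ∀ h ∈ V, ∀ n ∈ Sc h, i h < n ∧ n ≤ M ∧ 0 ≤ ∑ y ∈ E n * {g h}, ψ y) :
    ∃ U : Finset G, ((V \ U).card : ℝ) ≤ 7 * ε * U.card ∧
      -(4 * K * ε) * U.card ≤ ∑ y ∈ U, ψ y ∧
      ∀ y ∈ U, ∃ h ∈ V, ∃ n ∈ Sc h, y ∈ E n * {g h} := by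
  have hK0 : 0 ≤ K := (abs_nonneg _).trans (hK 1)
  have hψ : ∀ h ∈ V, ∀ n ∈ Sc h, ∀ T' ⊆ E n * {h} ∩ (E n * {g h}),
      (1 - 2 * ε) * (E n).card ≤ T'.card → -(4 * K * ε) * T'.card ≤ ∑ y ∈ T', ψ y := by
    intro h hh n hn T' hT' hT'c
    have hsub : T' ⊆ E n * {g h} := hT'.trans Finset.inter_subset_right
    have hsum := (hs h hh n hn).2.2
    rw [← Finset.sum_sdiff hsub] at hsum
    have hrest : ∑ y ∈ (E n * {g h}) \ T', ψ y ≤ ((E n * {g h}) \ T').card * K := by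
      rw [← nsmul_eq_mul]
      exact Finset.sum_le_card_nsmul _ _ _ fun y _ => (le_abs_self _).trans (hK y)
    have hc : (((E n * {g h}) \ T').card : ℝ) = (E n).card - T'.card := by
      rw [Finset.card_sdiff_of_subset hsub, Nat.cast_sub (Finset.card_le_card hsub),
        Finset.card_mul_singleton]
    rw [hc] at hrest
    have hT0 : (0 : ℝ) ≤ T'.card := Nat.cast_nonneg _
    -- `T'` misses at most `2 * ε` of the tile, hence at most `4 * ε * T'.card` points when `ε ≤ 1 /
    -- 4`; each costs at most `K`.
    have hA : ((E n).card : ℝ) - T'.card ≤ 4 * ε * T'.card := by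
      have : (1 : ℝ) * (E n).card ≤ (1 + 4 * ε) * (1 - 2 * ε) * (E n).card :=
        mul_le_mul_of_nonneg_right (by nlinarith) (Nat.cast_nonneg _)
      nlinarith
    nlinarith [mul_le_mul_of_nonneg_right hA hK0]
  obtain ⟨U, hU1, hU2, hU3⟩ := exists_efficient_cover (E := E) (V := V)
    (T := fun h n => E n * {h} ∩ (E n * {g h})) (Sc := Sc) (ψ := ψ) (κ := 4 * K * ε)
    hE h1 ht.1 hε hε' hL (fun h hh n hn => (hs h hh n hn).2.1) hSc
    (fun h hh n hn => Finset.inter_subset_left)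
    (fun h hh n hn => ht.2.card_mul_singleton_inter h1 (hs h hh n hn).1 (hg h hh)) hψ
  refine ⟨U, hU1, hU2, fun y hy => ?_⟩
  obtain ⟨h, hh, n, hn, hy⟩ := hU3 y hy
  exact ⟨h, hh, n, hn, (Finset.mem_inter.1 hy).2⟩

/-! ### Growth along fluctuations. -/

/-- Along the tiles around `g`, the averages of `φ` fluctuate `R` times across `(α, β)` at scales
in `(i, M]`. -/
def FluctuatesBetween {G : Type*} [Group G] [DecidableEq G] (E : ℕ → Finset G) (φ : G → ℝ)
    (α β : ℝ) (M R i : ℕ) (g : G) : Prop :=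
  ∃ s : ℕ → ℕ, (∀ j < 2 * R, i < s j ∧ s j ≤ M) ∧ (∀ j k, j < k → k < 2 * R → s j < s k) ∧
    ∀ j < R, 0 ≤ ∑ y ∈ E (s (2 * j)) * {g}, (α - φ y) ∧
      0 ≤ ∑ y ∈ E (s (2 * j + 1)) * {g}, (φ y - β)

/-- `R` fluctuations yield `L` scales of low averages and `L` scales of high averages, any of which
can be followed by `R - L` further fluctuations. -/
theorem FluctuatesBetween.exists_scales {G : Type*} [Group G] [DecidableEq G] {E : ℕ → Finset G}
    {φ : G → ℝ} {α β : ℝ} {M R L i : ℕ} {g : G}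
    (h : FluctuatesBetween E φ α β M (L + R) i g) :
    ∃ P Q : Finset ℕ, L ≤ P.card ∧ L ≤ Q.card ∧
      (∀ n ∈ P, i < n ∧ n ≤ M ∧ 0 ≤ ∑ y ∈ E n * {g}, (α - φ y) ∧
        FluctuatesBetween E φ α β M R n g) ∧
      (∀ n ∈ Q, i < n ∧ n ≤ M ∧ 0 ≤ ∑ y ∈ E n * {g}, (φ y - β) ∧
        FluctuatesBetween E φ α β M R n g) := by
  obtain ⟨s, hs, hmono, hfl⟩ := h
  have hrest : ∀ t, t < 2 * L → FluctuatesBetween E φ α β M R (s t) g := by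
    intro t ht
    refine ⟨fun j => s (2 * L + j), fun j hj => ⟨hmono _ _ (by omega) (by omega),
      (hs _ (by omega)).2⟩, fun j k hjk hk => hmono _ _ (by omega) (by omega), fun j hj => ?_⟩
    have := hfl (L + j) (by omega)
    rwa [mul_add, add_assoc] at this
  have hinj : ∀ j k, j < 2 * (L + R) → k < 2 * (L + R) → s j = s k → j = k := by
    intro j k hj hk hjk
    rcases lt_trichotomy j k with h | h | h
    · have := hmono j k h hk; omega
    · exact h
    · have := hmono k j h hj; omega
  refine ⟨(Finset.range L).image fun j => s (2 * j), (Finset.range L).image fun j => s (2 * j + 1),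
    ?_, ?_, ?_, ?_⟩
  · rw [Finset.card_image_of_injOn, Finset.card_range]
    intro j hj k hk hjk
    simp only [Finset.coe_range, Set.mem_Iio] at hj hk
    have := hinj _ _ (by omega) (by omega) hjk
    omega
  · rw [Finset.card_image_of_injOn, Finset.card_range]
    intro j hj k hk hjk
    simp only [Finset.coe_range, Set.mem_Iio] at hj hk
    have := hinj _ _ (by omega) (by omega) hjk
    omega
  · intro n hn
    obtain ⟨j, hj, rfl⟩ := Finset.mem_image.1 hn
    rw [Finset.mem_range] at hj
    exact ⟨(hs _ (by omega)).1, (hs _ (by omega)).2, (hfl j (by omega)).1, hrest _ (by omega)⟩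
  · intro n hn
    obtain ⟨j, hj, rfl⟩ := Finset.mem_image.1 hn
    rw [Finset.mem_range] at hj
    exact ⟨(hs _ (by omega)).1, (hs _ (by omega)).2, (hfl j (by omega)).2, hrest _ (by omega)⟩

/-- If the sum of `φ` is low on `V` and high on `U`, and `U` covers most of `V`, then `U` is
definitely larger than `V`. -/
theorem card_mul_le_of_sum_le {G : Type*} [DecidableEq G] {U V : Finset G} {φ : G → ℝ}
    {α β K ε κ : ℝ} (hK : ∀ y, |φ y - β| ≤ K)
    (hV : -κ * V.card ≤ ∑ y ∈ V, (α - φ y)) (hU : -κ * U.card ≤ ∑ y ∈ U, (φ y - β))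
    (hVU : ((V \ U).card : ℝ) ≤ 7 * ε * U.card) :
    (β - α + K - κ) * V.card ≤ (K + 14 * K * ε + κ) * U.card := by
  have hrest : ∀ A B : Finset G, ∑ y ∈ A \ B, (φ y - β) ≤ (A \ B).card * K := by
    intro A B
    rw [← nsmul_eq_mul]
    exact Finset.sum_le_card_nsmul _ _ _ fun y _ => (le_abs_self _).trans (hK y)
  have hrest' : -((V \ U).card * K) ≤ ∑ y ∈ V \ U, (φ y - β) := by
    have := Finset.card_nsmul_le_sum (V \ U) (fun y => φ y - β) (-K)
      fun y _ => (abs_le.1 (hK y)).1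
    rw [nsmul_eq_mul] at this
    linarith
  have e1 : ∑ y ∈ U \ V, (φ y - β) + ∑ y ∈ U ∩ V, (φ y - β) = ∑ y ∈ U, (φ y - β) := by
    rw [add_comm, Finset.sum_inter_add_sum_sdiff]
  have e2 : ∑ y ∈ V \ U, (φ y - β) + ∑ y ∈ U ∩ V, (φ y - β) = ∑ y ∈ V, (φ y - β) := by
    rw [add_comm, Finset.inter_comm, Finset.sum_inter_add_sum_sdiff]
  have e3 : ∑ y ∈ V, (φ y - β) = -∑ y ∈ V, (α - φ y) - (β - α) * V.card := by
    rw [← Finset.sum_neg_distrib, mul_comm, ← nsmul_eq_mul, ← Finset.sum_const,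
      ← Finset.sum_sub_distrib]
    exact Finset.sum_congr rfl fun y _ => by ring
  have c1 : ((U \ V).card : ℝ) + (U ∩ V).card = U.card := by
    rw [add_comm]; exact_mod_cast Finset.card_inter_add_card_sdiff U V
  have c2 : ((V \ U).card : ℝ) + (U ∩ V).card = V.card := by
    rw [add_comm, Finset.inter_comm]; exact_mod_cast Finset.card_inter_add_card_sdiff V U
  have hK0 : 0 ≤ K ∨ (U.card : ℝ) = 0 := by
    rcases U.eq_empty_or_nonempty with rfl | ⟨y, -⟩
    · right; simp
    · exact Or.inl ((abs_nonneg _).trans (hK y))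
  have hVU' : K * ((V \ U).card : ℝ) ≤ K * (7 * ε * U.card) := by
    rcases hK0 with h | h
    · exact mul_le_mul_of_nonneg_left hVU h
    · have : ((V \ U).card : ℝ) = 0 := le_antisymm (by rw [h] at hVU; linarith) (Nat.cast_nonneg _)
      rw [h, this]; simp
  have := hrest U V
  -- The sums over `U` and `V` differ by at most `K * (|U \ V| + |V \ U|)`; this identity leaves `|V
  -- \ U|` counted twice, whence the term `14 * K * ε`.
  have c3 : ((U \ V).card : ℝ) = U.card - V.card + (V \ U).card := by linarith
  rw [c3] at this
  nlinarith

/-- One round: a set of points that fluctuate often near `B` grows by a definite factor. -/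
theorem exists_card_growth {G : Type*} [Group G] [DecidableEq G] {E : ℕ → Finset G}
    {φ : G → ℝ} {α β K γ ε : ℝ} {M L R : ℕ} {B V : Finset G}
    (hE : ∀ n, (E n).Nonempty) (h1 : 1 ∈ E 0) (ht : IsBiTempered (1 + ε) E)
    (hγ : 0 < γ) (hγ' : γ ≤ 1) (hε : 100 * ε = γ) (hL : 1 ≤ ε ^ 2 * L) (hK : 0 < K)
    (hγK : γ * K = β - α) (hα : ∀ y, |α - φ y| ≤ K) (hβ : ∀ y, |φ y - β| ≤ K)
    (hV : ∀ h ∈ V, ∃ g ∈ B, ∃ i ≤ M, h ∈ E i * {g} ∧ FluctuatesBetween E φ α β M (2 * L + R) i g) :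
    ∃ U : Finset G, (1 + γ / 2) * V.card ≤ U.card ∧
      ∀ h ∈ U, ∃ g ∈ B, ∃ i ≤ M, h ∈ E i * {g} ∧ FluctuatesBetween E φ α β M R i g := by
  have hε0 : 0 < ε := by linarith
  have hε1 : ε ≤ 1 / 4 := by linarith
  have half : ∀ (R' : ℕ) (V : Finset G), (∀ h ∈ V, ∃ g ∈ B, ∃ i ≤ M, h ∈ E i * {g} ∧
      FluctuatesBetween E φ α β M (L + R') i g) → ∀ h : G, ∃ g : G, ∃ i : ℕ, ∃ P Q : Finset ℕ,
      h ∈ V → g ∈ B ∧ h ∈ E i * {g} ∧ L ≤ P.card ∧ L ≤ Q.card ∧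
      (∀ n ∈ P, i < n ∧ n ≤ M ∧ 0 ≤ ∑ y ∈ E n * {g}, (α - φ y) ∧
        FluctuatesBetween E φ α β M R' n g) ∧
      (∀ n ∈ Q, i < n ∧ n ≤ M ∧ 0 ≤ ∑ y ∈ E n * {g}, (φ y - β) ∧
        FluctuatesBetween E φ α β M R' n g) := by
    intro R' V hV h
    by_cases hh : h ∈ V
    · obtain ⟨g, hg, i, -, hi, hfl⟩ := hV h hh
      obtain ⟨P, Q, h⟩ := hfl.exists_scales
      exact ⟨g, i, P, Q, fun _ => ⟨hg, hi, h⟩⟩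
    · exact ⟨1, 0, ∅, ∅, fun h => absurd h hh⟩
  -- The `2 * L` fluctuations of a round are split: `L` for the low cover, `L` for the high one.
  choose g i P Q H using half (L + R) V (by rwa [← add_assoc, ← two_mul])
  obtain ⟨V', hV1, hV2, hV3⟩ := exists_cover_of_sum_nonneg (V := V) (g := g) (i := i) (Sc := P)
    (ψ := fun y => α - φ y) hE h1 ht hε0 hε1 hL hα (fun h hh => (H h hh).2.2.1)
    (fun h hh => (H h hh).2.1) (M := M)
    (fun h hh n hn => by
      obtain ⟨a, b, c, -⟩ := (H h hh).2.2.2.2.1 n hn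
      exact ⟨a, b, c⟩)
  have hV4 : ∀ h ∈ V', ∃ g ∈ B, ∃ i ≤ M, h ∈ E i * {g} ∧
      FluctuatesBetween E φ α β M (L + R) i g := by
    intro y hy
    obtain ⟨h, hh, n, hn, hy⟩ := hV3 y hy
    obtain ⟨-, b, -, d⟩ := (H h hh).2.2.2.2.1 n hn
    exact ⟨g h, (H h hh).1, n, b, hy, d⟩
  clear H
  choose g i P Q H using half R V' hV4
  obtain ⟨U, hU1, hU2, hU3⟩ := exists_cover_of_sum_nonneg (V := V') (g := g) (i := i) (Sc := Q)
    (ψ := fun y => φ y - β) hE h1 ht hε0 hε1 hL hβ (fun h hh => (H h hh).2.2.2.1)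
    (fun h hh => (H h hh).2.1) (M := M)
    (fun h hh n hn => by
      obtain ⟨a, b, c, -⟩ := (H h hh).2.2.2.2.2 n hn
      exact ⟨a, b, c⟩)
  refine ⟨U, ?_, fun y hy => ?_⟩
  · have hgrow := card_mul_le_of_sum_le hβ hV2 hU2 hU1
    have hVV' : (V.card : ℝ) ≤ (1 + 7 * ε) * V'.card := by
      have : V.card ≤ V'.card + (V \ V').card := by
        rw [add_comm]
        exact Finset.card_le_card_sdiff_add_card
      have : (V.card : ℝ) ≤ V'.card + (V \ V').card := by exact_mod_cast this
      linarith
    have hgrow' : (1 + γ - 4 * ε) * V'.card ≤ (1 + 18 * ε) * U.card := by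
      refine le_of_mul_le_mul_left ?_ hK
      rw [← hγK] at hgrow
      linarith
    have hU0 : (0 : ℝ) ≤ U.card := Nat.cast_nonneg _
    have hV0 : (0 : ℝ) ≤ V'.card := Nat.cast_nonneg _
    have a1 : (1 + γ / 2) * (V.card : ℝ) ≤ (1 + γ / 2) * ((1 + 7 * ε) * V'.card) :=
      mul_le_mul_of_nonneg_left hVV' (by linarith)
    -- With `ε = γ / 100`, all covering losses together consume less than half of the gain `γ`.
    have a2 : (1 + 18 * ε) * ((1 + γ / 2) * (1 + 7 * ε)) ≤ 1 + γ - 4 * ε := by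
      obtain rfl : ε = γ / 100 := by linarith
      nlinarith [mul_nonneg hγ.le (sub_nonneg.2 hγ'),
        mul_nonneg (mul_nonneg hγ.le hγ.le) (sub_nonneg.2 hγ')]
    have a3 := mul_le_mul_of_nonneg_right a2 hV0
    refine a1.trans (le_of_mul_le_mul_left ?_ (show (0 : ℝ) < 1 + 18 * ε by linarith))
    linarith
  · obtain ⟨h, hh, n, hn, hy⟩ := hU3 y hy
    obtain ⟨-, b, -, d⟩ := (H h hh).2.2.2.2.2 n hn
    exact ⟨g h, (H h hh).1, n, b, hy, d⟩

/-- Iterates the growth round `k` times from `V = B`, where `1 ∈ E 0` puts each `g` in its own tile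
at scale 0. Keeping the centres in `B` and the scales at most `M` confines the final set. -/
theorem card_mul_pow_le_of_fluctuatesBetween {G : Type*} [Group G] [DecidableEq G]
    {E : ℕ → Finset G} {φ : G → ℝ} {α β K γ ε : ℝ} {M L k : ℕ} {B : Finset G}
    (hE : ∀ n, (E n).Nonempty) (h1 : 1 ∈ E 0) (ht : IsBiTempered (1 + ε) E)
    (hγ : 0 < γ) (hγ' : γ ≤ 1) (hε : 100 * ε = γ) (hL : 1 ≤ ε ^ 2 * L) (hK : 0 < K)
    (hγK : γ * K = β - α) (hα : ∀ y, |α - φ y| ≤ K) (hβ : ∀ y, |φ y - β| ≤ K)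
    (hB : ∀ g ∈ B, FluctuatesBetween E φ α β M (2 * L * k) 0 g) :
    (1 + γ / 2) ^ k * B.card ≤ (((Finset.range (M + 1)).biUnion E * B).card : ℝ) := by
  have main : ∀ k (V : Finset G), (∀ h ∈ V, ∃ g ∈ B, ∃ i ≤ M, h ∈ E i * {g} ∧
      FluctuatesBetween E φ α β M (2 * L * k) i g) →
      (1 + γ / 2) ^ k * V.card ≤ (((Finset.range (M + 1)).biUnion E * B).card : ℝ) := by
    intro k
    induction k with
    | zero =>
      intro V hV
      rw [pow_zero, one_mul, Nat.cast_le]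
      refine Finset.card_le_card fun h hh => ?_
      obtain ⟨g, hg, i, hi, hh, -⟩ := hV h hh
      refine Finset.mul_subset_mul ?_ (Finset.singleton_subset_iff.2 hg) hh
      exact Finset.subset_biUnion_of_mem E (Finset.mem_range.2 (by omega))
    | succ k ih =>
      intro V hV
      obtain ⟨U, hU1, hU2⟩ := exists_card_growth (R := 2 * L * k) hE h1 ht hγ hγ' hε hL hK hγK hα hβ
        (V := V) (by rwa [mul_add, mul_one, add_comm] at hV)
      refine le_trans ?_ (ih U hU2)
      rw [pow_succ, mul_assoc]
      exact mul_le_mul_of_nonneg_left hU1 (by positivity)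
  exact main k B fun g hg => ⟨g, hg, 0, Nat.zero_le _, Finset.mem_mul.2
    ⟨1, h1, g, Finset.mem_singleton_self g, one_mul g⟩, hB g hg⟩

/-! ### Transference to the probability space. -/

/-- For large `n` each `g ∈ Q` adds at most `|F n| / (|Q| + 1)` new points, so all of `Q` adds at
most `|F n|`. -/
theorem IsLeftFolnerSeq.exists_card_mul_le {G : Type*} [Group G] [DecidableEq G]
    {F : ℕ → Finset G} (hF : IsLeftFolnerSeq F) (Q : Finset G) :
    ∃ K : Finset G, K.Nonempty ∧ ((Q * K).card : ℝ) ≤ 2 * K.card := by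
  let _ : MeasurableSpace G := ⊤
  obtain ⟨hne, hfol⟩ := hF
  have hev : ∀ g : G, ∀ᶠ n in atTop,
      (((Q.card + 1 : ℕ) : ℝ)) * ((g • F n) \ F n).card ≤ (F n).card := by
    intro g
    have hpos : (0 : ℝ≥0∞) < ((Q.card + 1 : ℕ) : ℝ≥0∞)⁻¹ := by simp
    filter_upwards [(hfol.tendsto_meas_smul_symmDiff g).eventually (gt_mem_nhds hpos)] with n hn
    have hn0 : (Measure.count (F n : Set G) : ℝ≥0∞) ≠ 0 := by
      rw [Measure.count_apply_finset]
      simpa using (hne n).ne_empty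
    have hntop : (Measure.count (F n : Set G) : ℝ≥0∞) ≠ ∞ := by
      rw [Measure.count_apply_finset]
      exact ENNReal.natCast_ne_top _
    have h1 := (ENNReal.div_lt_iff (Or.inl hn0) (Or.inl hntop)).1 hn
    have h2 : (Measure.count (((g • F n) \ F n : Finset G) : Set G) : ℝ≥0∞) ≤
        Measure.count (symmDiff (g • (F n : Set G)) (F n : Set G)) := by
      refine measure_mono ?_
      rw [Finset.coe_sdiff, Finset.coe_smul_finset]
      exact le_sup_left
    have h3 := h2.trans h1.le
    rw [Measure.count_apply_finset, Measure.count_apply_finset] at h3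
    have h4 : ((Q.card + 1 : ℕ) : ℝ≥0∞) * ((g • F n) \ F n).card ≤ (F n).card := by
      calc ((Q.card + 1 : ℕ) : ℝ≥0∞) * ((g • F n) \ F n).card
          ≤ ((Q.card + 1 : ℕ) : ℝ≥0∞) * (((Q.card + 1 : ℕ) : ℝ≥0∞)⁻¹ * (F n).card) := by gcongr
        _ = (F n).card := by
          rw [← mul_assoc, ENNReal.mul_inv_cancel (by simp) (ENNReal.natCast_ne_top _), one_mul]
    exact_mod_cast h4
  obtain ⟨n, hn⟩ := ((Finset.eventually_all Q).2 fun g _ => hev g).exists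
  refine ⟨F n, hne n, ?_⟩
  have hsub : Q * F n ⊆ F n ∪ Q.biUnion fun g => (g • F n) \ F n := by
    intro y hy
    obtain ⟨q, hq, x, hx, rfl⟩ := Finset.mem_mul.1 hy
    by_cases h : q * x ∈ F n
    · exact Finset.mem_union_left _ h
    · exact Finset.mem_union_right _ (Finset.mem_biUnion.2
        ⟨q, hq, Finset.mem_sdiff.2 ⟨Finset.smul_mem_smul_finset hx, h⟩⟩)
  have hcard : ((Q * F n).card : ℝ) ≤ (F n).card + ∑ g ∈ Q, (((g • F n) \ F n).card : ℝ) := by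
    exact_mod_cast (Finset.card_le_card hsub).trans
      ((Finset.card_union_le _ _).trans (Nat.add_le_add_left Finset.card_biUnion_le _))
  have hQ : (0 : ℝ) < ((Q.card + 1 : ℕ) : ℝ) := by positivity
  have hsum : ∑ g ∈ Q, (((g • F n) \ F n).card : ℝ) ≤
      Q.card * ((F n).card / ((Q.card + 1 : ℕ) : ℝ)) := by
    rw [← nsmul_eq_mul]
    refine Finset.sum_le_card_nsmul _ _ _ fun g hg => ?_
    rw [le_div_iff₀ hQ, mul_comm]
    exact hn g hg
  have hfrac : (Q.card : ℝ) * ((F n).card / ((Q.card + 1 : ℕ) : ℝ)) ≤ (F n).card := by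
    rw [mul_div_assoc', div_le_iff₀ hQ]
    push_cast
    nlinarith [(Nat.cast_nonneg (F n).card : (0 : ℝ) ≤ _)]
  linarith

/-- The points whose averages fluctuate `N` times at scales at most `M`. -/
def boundedFluctuationSet {G X : Type*} [Group G] [MulAction G X]
    (F : ℕ → Finset G) (f : X → ℝ) (α β : ℝ) (N M : ℕ) : Set X :=
  {x | ∃ n : Fin (2 * N) → ℕ, (StrictMono n ∧ ∀ i, n i ≤ M) ∧
    ∀ i : Fin (2 * N), (Odd ((i : ℕ) + 1) → ergodicAverage (F (n i)) f x ≤ α) ∧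
      (Even ((i : ℕ) + 1) → β ≤ ergodicAverage (F (n i)) f x)}

theorem iUnion_boundedFluctuationSet {G X : Type*} [Group G] [MulAction G X]
    (F : ℕ → Finset G) (f : X → ℝ) (α β : ℝ) (N : ℕ) :
    ⋃ M, boundedFluctuationSet F f α β N M = fluctuationSet F f α β N := by
  ext x
  simp only [Set.mem_iUnion, boundedFluctuationSet, fluctuationSet, Fluctuates, Set.mem_ofPred_eq]
  constructor
  · rintro ⟨M, n, hn, h⟩
    exact ⟨n, hn.1, h⟩
  · rintro ⟨n, hn, h⟩
    exact ⟨Finset.univ.sup n, n, ⟨hn, fun i => Finset.le_sup (Finset.mem_univ i)⟩, h⟩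

theorem monotone_boundedFluctuationSet {G X : Type*} [Group G] [MulAction G X]
    (F : ℕ → Finset G) (f : X → ℝ) (α β : ℝ) (N : ℕ) :
    Monotone (boundedFluctuationSet F f α β N) :=
  fun _ _ hM _ ⟨n, hn, h⟩ => ⟨n, ⟨hn.1, fun i => (hn.2 i).trans hM⟩, h⟩

theorem measurableSet_boundedFluctuationSet {G X : Type*} [Group G] [MulAction G X]
    [MeasurableSpace X] (hG : ∀ g : G, Measurable fun x : X => g • x)
    (F : ℕ → Finset G) {f : X → ℝ} (hf : Measurable f) (α β : ℝ) (N M : ℕ) :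
    MeasurableSet (boundedFluctuationSet F f α β N M) := by
  have hav : ∀ n, Measurable (ergodicAverage (F n) f) := fun n =>
    (Finset.measurable_sum _ fun g _ => hf.comp (hG g)).const_mul _
  have : boundedFluctuationSet F f α β N M = ⋃ n : Fin (2 * N) → ℕ,
      {_x | StrictMono n ∧ ∀ i, n i ≤ M} ∩ ⋂ i : Fin (2 * N),
        ({_x | ¬ Odd ((i : ℕ) + 1)} ∪ {x | ergodicAverage (F (n i)) f x ≤ α}) ∩
        ({_x | ¬ Even ((i : ℕ) + 1)} ∪ {x | β ≤ ergodicAverage (F (n i)) f x}) := by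
    ext x
    simp only [boundedFluctuationSet, Set.mem_ofPred_eq, Set.mem_iUnion, Set.mem_inter_iff,
      Set.mem_iInter, Set.mem_union, imp_iff_not_or]
  rw [this]
  refine MeasurableSet.iUnion fun n => (MeasurableSet.const _).inter (MeasurableSet.iInter fun i =>
    ((MeasurableSet.const _).union ?_).inter ((MeasurableSet.const _).union ?_))
  · exact measurableSet_le (hav _) measurable_const
  · exact measurableSet_le measurable_const (hav _)

theorem sum_mul_singleton_smul {G X : Type*} [Group G] [DecidableEq G] [MulAction G X]
    (A : Finset G) (f : X → ℝ) (g : G) (x : X) :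
    ∑ y ∈ A * {g}, f (y • x) = ∑ h ∈ A, f (h • g • x) := by
  have : A * {g} = A.image fun a => a * g := by
    ext y
    simp only [Finset.mem_mul, Finset.mem_singleton, Finset.mem_image, exists_eq_left]
  rw [this, Finset.sum_image fun a _ b _ h => mul_right_cancel h]
  simp only [mul_smul]

theorem sum_smul_eq_card_mul_ergodicAverage {G X : Type*} [Group G] [MulAction G X]
    {A : Finset G} (hA : A.Nonempty) (f : X → ℝ) (x : X) :
    ∑ h ∈ A, f (h • x) = A.card * ergodicAverage A f x := by
  have : (A.card : ℝ) ≠ 0 := by exact_mod_cast hA.card_pos.ne'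
  rw [ergodicAverage, mul_inv_cancel_left₀ this]

theorem fluctuatesBetween_of_mem {G X : Type*} [Group G] [DecidableEq G] [MulAction G X]
    {E : ℕ → Finset G} (hE : ∀ n, (E n).Nonempty) {f : X → ℝ} {α β : ℝ} {N R M : ℕ}
    (hR : R + 1 ≤ N) {g : G} {x : X} (h : g • x ∈ boundedFluctuationSet E f α β N M) :
    FluctuatesBetween E (fun y => f (y • x)) α β M R 0 g := by
  obtain ⟨n, ⟨hmono, hM⟩, hn⟩ := h
  -- The first fluctuation is dropped so that all scales used are strictly above 0; the value 0
  -- outside the range is never used.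
  have hs : ∀ j (hj : j < 2 * R), (if h : j + 2 < 2 * N then n ⟨j + 2, h⟩ else 0) =
      n ⟨j + 2, by omega⟩ := fun j hj => dif_pos _
  have hlow : ∀ A : Finset G, ∑ y ∈ A * {g}, (α - f (y • x)) =
      A.card * α - ∑ h ∈ A, f (h • g • x) := by
    intro A
    rw [Finset.sum_sub_distrib, Finset.sum_const, Finset.card_mul_singleton,
      sum_mul_singleton_smul, nsmul_eq_mul]
  have hhigh : ∀ A : Finset G, ∑ y ∈ A * {g}, (f (y • x) - β) =
      ∑ h ∈ A, f (h • g • x) - A.card * β := by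
    intro A
    rw [Finset.sum_sub_distrib, Finset.sum_const, Finset.card_mul_singleton,
      sum_mul_singleton_smul, nsmul_eq_mul]
  refine ⟨fun j => if h : j + 2 < 2 * N then n ⟨j + 2, h⟩ else 0, ?_, ?_, ?_⟩
  · intro j hj
    simp only [hs j hj]
    exact ⟨(Nat.zero_le _).trans_lt (hmono (show (⟨0, by omega⟩ : Fin (2 * N)) < ⟨j + 2, by omega⟩
      from Fin.mk_lt_mk.2 (by omega))), hM _⟩
  · intro j k hjk hk
    simp only [hs j (hjk.trans hk), hs k hk]
    exact hmono (Fin.mk_lt_mk.2 (by omega))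
  · intro j hj
    simp only [hs (2 * j) (by omega), hs (2 * j + 1) (by omega), hlow, hhigh,
      sum_smul_eq_card_mul_ergodicAverage (hE _)]
    constructor
    · have := (hn ⟨2 * j + 2, by omega⟩).1 ⟨j + 1, by simp; ring⟩
      rw [sub_nonneg]
      exact mul_le_mul_of_nonneg_left this (Nat.cast_nonneg _)
    · have := (hn ⟨2 * j + 1 + 2, by omega⟩).2 ⟨j + 2, by simp; ring⟩
      rw [sub_nonneg]
      exact mul_le_mul_of_nonneg_left this (Nat.cast_nonneg _)

/-- Transference: a bound on the density of visits along orbits bounds the measure. -/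
theorem measureReal_le_of_card_filter_le {G X : Type*} [Group G] [MulAction G X]
    [MeasurableSpace X] {μ : Measure X} [IsProbabilityMeasure μ]
    (hG : ∀ g : G, MeasurePreserving (fun x : X => g • x) μ μ) {D : Set X} (hD : MeasurableSet D)
    [∀ x, DecidablePred fun g : G => g • x ∈ D]
    {K : Finset G} (hK : K.Nonempty) {C : ℝ}
    (h : ∀ x, ((K.filter fun g => g • x ∈ D).card : ℝ) ≤ C * K.card) : μ.real D ≤ C := by
  have hK0 : (0 : ℝ) < K.card := by exact_mod_cast hK.card_pos
  have hm : ∀ g : G, MeasurableSet ((fun x : X => g • x) ⁻¹' D) := fun g => (hG g).measurable hD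
  have hint : ∀ g ∈ K, Integrable (((fun x : X => g • x) ⁻¹' D).indicator fun _ => (1 : ℝ)) μ :=
    fun g _ => (integrable_const 1).indicator (hm g)
  have h1 : ∫ x, ∑ g ∈ K, ((fun x : X => g • x) ⁻¹' D).indicator (fun _ => (1 : ℝ)) x ∂μ =
      K.card * μ.real D := by
    rw [integral_finsetSum _ hint, ← nsmul_eq_mul, ← Finset.sum_const]
    refine Finset.sum_congr rfl fun g _ => ?_
    rw [integral_indicator_const _ (hm g), smul_eq_mul, mul_one, measureReal_def, measureReal_def,
      (hG g).measure_preimage hD.nullMeasurableSet]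
  have h2 : ∫ x, ∑ g ∈ K, ((fun x : X => g • x) ⁻¹' D).indicator (fun _ => (1 : ℝ)) x ∂μ ≤
      ∫ _, C * K.card ∂μ := by
    refine integral_mono (integrable_finsetSum _ hint) (integrable_const _) fun x => ?_
    refine le_trans (le_of_eq ?_) (h x)
    rw [Finset.card_filter]
    push_cast
    refine Finset.sum_congr rfl fun g _ => ?_
    by_cases hg : g • x ∈ D
    · rw [if_pos hg, Set.indicator_of_mem (Set.mem_preimage.2 hg)]
    · rw [if_neg hg, Set.indicator_of_notMem (mt Set.mem_preimage.1 hg)]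
  rw [h1, integral_const, probReal_univ, one_smul] at h2
  refine le_of_mul_le_mul_right ?_ hK0
  linarith

theorem measureReal_fluctuationSet_le_of_measurable {G X : Type*} [Group G] [DecidableEq G]
    [MulAction G X] [MeasurableSpace X] {μ : Measure X} [IsProbabilityMeasure μ]
    (hG : ∀ g : G, MeasurePreserving (fun x : X => g • x) μ μ)
    {E : ℕ → Finset G} {f : X → ℝ} {α β K γ ε : ℝ} {L k N : ℕ}
    (hFol : ∀ Q : Finset G, ∃ A : Finset G, A.Nonempty ∧ ((Q * A).card : ℝ) ≤ 2 * A.card)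
    (hE : ∀ n, (E n).Nonempty) (h1 : 1 ∈ E 0) (ht : IsBiTempered (1 + ε) E)
    (hγ : 0 < γ) (hγ' : γ ≤ 1) (hε : 100 * ε = γ) (hL : 1 ≤ ε ^ 2 * L) (hK : 0 < K)
    (hγK : γ * K = β - α) (hf : Measurable f) (hα : ∀ y, |α - f y| ≤ K)
    (hβ : ∀ y, |f y - β| ≤ K) (hN : 2 * L * k + 1 ≤ N) :
    μ.real (fluctuationSet E f α β N) ≤ 2 * ((1 + γ / 2) ^ k)⁻¹ := by
  classical
  have hb : ∀ M, μ.real (boundedFluctuationSet E f α β N M) ≤ 2 * ((1 + γ / 2) ^ k)⁻¹ := by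
    intro M
    obtain ⟨A, hA, hQA⟩ := hFol ((Finset.range (M + 1)).biUnion E)
    refine measureReal_le_of_card_filter_le hG
      (measurableSet_boundedFluctuationSet (fun g => (hG g).measurable) E hf α β N M) hA fun x => ?_
    have hcard := card_mul_pow_le_of_fluctuatesBetween (φ := fun y => f (y • x)) (M := M) (k := k)
      (B := A.filter fun g => g • x ∈ boundedFluctuationSet E f α β N M)
      hE h1 ht hγ hγ' hε hL hK hγK (fun y => hα _) (fun y => hβ _)
      fun g hg => fluctuatesBetween_of_mem hE hN (Finset.mem_filter.1 hg).2
    have hle : (((Finset.range (M + 1)).biUnion E *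
        A.filter fun g => g • x ∈ boundedFluctuationSet E f α β N M).card : ℝ) ≤ 2 * A.card :=
      (Nat.cast_le.2 (Finset.card_le_card
        (Finset.mul_subset_mul_left (Finset.filter_subset _ _)))).trans hQA
    have hpos : 0 < (1 + γ / 2) ^ k := by positivity
    rw [mul_comm (2 : ℝ), mul_assoc, ← div_eq_inv_mul, le_div_iff₀ hpos, mul_comm]
    exact hcard.trans hle
  rw [← iUnion_boundedFluctuationSet, measureReal_def,
    (monotone_boundedFluctuationSet E f α β N).measure_iUnion]
  refine ENNReal.toReal_le_of_le_ofReal (by positivity) (iSup_le fun M => ?_)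
  rw [← ENNReal.ofReal_toReal (measure_ne_top μ (boundedFluctuationSet E f α β N M))]
  exact ENNReal.ofReal_le_ofReal (hb M)

theorem fluctuationSet_ae_eq {G X : Type*} [Group G] [Countable G] [MulAction G X]
    [MeasurableSpace X] {μ : Measure X}
    (hG : ∀ g : G, MeasurePreserving (fun x : X => g • x) μ μ)
    {f f' : X → ℝ} (h : f =ᵐ[μ] f') (F : ℕ → Finset G) (α β : ℝ) (N : ℕ) :
    fluctuationSet F f α β N =ᵐ[μ] fluctuationSet F f' α β N := by
  have hall : ∀ᵐ x ∂μ, ∀ g : G, f (g • x) = f' (g • x) :=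
    ae_all_iff.2 fun g => (hG g).quasiMeasurePreserving.ae h
  refine eventuallyEq_set.2 ?_
  filter_upwards [hall] with x hx
  have : ∀ n, ergodicAverage (F n) f x = ergodicAverage (F n) f' x := fun n => by
    simp only [ergodicAverage, hx]
  simp only [fluctuationSet, Set.mem_ofPred_eq, this]

/-- Truncating a measurable representative gives a bound at every point, which the orbitwise
argument needs. -/
theorem exists_measurable_bounded_ae_eq {X : Type*} [MeasurableSpace X] {μ : Measure X}
    {f : X → ℝ} {S : ℝ} (hS : 0 ≤ S) (hf : AEStronglyMeasurable f μ)
    (hfS : eLpNorm f ∞ μ ≤ ENNReal.ofReal S) :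
    ∃ f' : X → ℝ, Measurable f' ∧ (∀ x, |f' x| ≤ S) ∧ f =ᵐ[μ] f' := by
  refine ⟨fun x => max (-S) (min S (hf.mk f x)), ?_, ?_, ?_⟩
  · exact measurable_const.max (measurable_const.min hf.stronglyMeasurable_mk.measurable)
  · intro x
    rw [abs_le]
    exact ⟨le_max_left _ _, max_le (by linarith) (min_le_left _ _)⟩
  · rw [eLpNorm_exponent_top] at hfS
    filter_upwards [hf.ae_eq_mk, ae_le_eLpNormEssSup (f := f) (μ := μ)] with x hx hxS
    have h1 : ‖f x‖ₑ ≤ ENNReal.ofReal S := hxS.trans hfS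
    rw [← ofReal_norm, ENNReal.ofReal_le_ofReal_iff hS, Real.norm_eq_abs, abs_le] at h1
    rw [← hx, min_eq_right h1.2, max_eq_right h1.1]

/-! ### Normalization of the sequence and exponential rate. -/

/-- Dropping the first `m` averages costs at most `m` fluctuations. -/
theorem Fluctuates.tail {a : ℕ → ℝ} {α β : ℝ} {N m : ℕ} (h : Fluctuates a α β (N + m)) :
    Fluctuates (fun n => a (m + n)) α β N := by
  obtain ⟨n, hmono, hn⟩ := h
  -- Since `n` is strictly increasing, `j ≤ n j`; discarding `2 * m` indices leaves only values at
  -- least `m` and preserves parity.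
  have hle : ∀ j (hj : j < 2 * (N + m)), j ≤ n ⟨j, hj⟩ := by
    intro j
    induction j with
    | zero => exact fun _ => Nat.zero_le _
    | succ j ih =>
      intro hj
      exact (ih (by omega)).trans_lt (hmono (Fin.mk_lt_mk.2 (Nat.lt_succ_self j)))
  have hm : ∀ i : Fin (2 * N), m ≤ n ⟨i + 2 * m, by omega⟩ := fun i =>
    le_trans (by omega) (hle _ _)
  refine ⟨fun i => n ⟨i + 2 * m, by omega⟩ - m, fun i j hij => ?_, fun i => ?_⟩
  · have : n ⟨i + 2 * m, by omega⟩ < n ⟨j + 2 * m, by omega⟩ :=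
      hmono (Fin.mk_lt_mk.2 (by have : (i : ℕ) < j := hij; omega))
    have := hm i
    show n ⟨i + 2 * m, by omega⟩ - m < n ⟨j + 2 * m, by omega⟩ - m
    omega
  · simp only [Nat.add_sub_cancel' (hm i)]
    refine ⟨fun ho => (hn _).1 ?_, fun he => (hn _).2 ?_⟩
    · rw [Nat.odd_iff] at ho ⊢
      simp only
      omega
    · rw [Nat.even_iff] at he ⊢
      simp only
      omega

theorem ergodicAverage_mul_singleton {G X : Type*} [Group G] [DecidableEq G] [MulAction G X]
    (A : Finset G) (a : G) (f : X → ℝ) (x : X) :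
    ergodicAverage (A * {a}) f x = ergodicAverage A f (a • x) := by
  rw [ergodicAverage, ergodicAverage, Finset.card_mul_singleton, sum_mul_singleton_smul]

theorem IsBiTempered.mul_singleton {G : Type*} [Group G] [DecidableEq G] {c : ℝ}
    {F : ℕ → Finset G} (h : IsBiTempered c F) (a : G) : IsBiTempered c fun n => F n * {a} := by
  refine ⟨fun n => ?_, fun n => ?_⟩
  · have : ((Finset.range n).biUnion fun i => (F i * {a})⁻¹ * (F n * {a})) =
        {a⁻¹} * ((Finset.range n).biUnion fun i => (F i)⁻¹ * F n) * {a} := by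
      rw [← Finset.coe_inj]
      push_cast
      simp only [mul_inv_rev, Set.inv_singleton, Set.mul_iUnion₂, Set.iUnion₂_mul, mul_assoc]
    simp only [this, Finset.card_mul_singleton, Finset.card_singleton_mul]
    exact h.1 n
  · have : ((Finset.range n).biUnion fun i => F n * {a} * (F i * {a})⁻¹) =
        (Finset.range n).biUnion fun i => F n * (F i)⁻¹ := by
      refine Finset.biUnion_congr rfl fun i _ => ?_
      rw [mul_inv_rev, Finset.inv_singleton, mul_assoc, ← mul_assoc ({a} : Finset G),
        Finset.singleton_mul_singleton, mul_inv_cancel, Finset.singleton_one, one_mul]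
    simp only [this, Finset.card_mul_singleton]
    exact h.2 n

/-- A bound that decays along multiples of `q` up to a bounded shift decays exponentially. -/
theorem exists_geometric_bound {lam : ℝ} (hlam : 1 < lam) {q : ℕ} (hq : 0 < q) (r : ℕ) :
    ∃ c₀ c₁ : ℝ, 0 < c₀ ∧ c₀ < 1 ∧ 0 < c₁ ∧ ∀ p : ℕ → ℝ, (∀ N, p N ≤ 1) →
      (∀ k N, q * k + r ≤ N → p N ≤ 2 * (lam ^ k)⁻¹) → ∀ N, p N ≤ c₁ * c₀ ^ N := by
  have hl0 : 0 < lam := by linarith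
  have hq' : (0 : ℝ) < q := by exact_mod_cast hq
  set c₀ : ℝ := lam⁻¹ ^ ((q : ℝ)⁻¹) with hc₀
  have h0 : 0 < c₀ := Real.rpow_pos_of_pos (inv_pos.2 hl0) _
  have h1 : c₀ < 1 :=
    Real.rpow_lt_one (inv_pos.2 hl0).le (inv_lt_one_of_one_lt₀ hlam) (inv_pos.2 hq')
  have hpow : c₀ ^ q = lam⁻¹ := Real.rpow_inv_natCast_pow (inv_pos.2 hl0).le hq.ne'
  -- The factor `c₀ ^ (q + r)` absorbs the shift `r` and the remainder modulo `q`, and makes the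
  -- bound trivial for `N < r`.
  refine ⟨c₀, 2 * (c₀ ^ (q + r))⁻¹, h0, h1, by positivity, fun p hp hpk N => ?_⟩
  have hpos : 0 < c₀ ^ (q + r) := by positivity
  rw [mul_assoc, ← div_eq_inv_mul]
  rcases lt_or_ge N r with hN | hN
  · refine (hp N).trans ?_
    have : 1 ≤ c₀ ^ N / c₀ ^ (q + r) := by
      rw [le_div_iff₀ hpos, one_mul]
      exact pow_le_pow_of_le_one h0.le h1.le (by omega)
    linarith
  · have hdm := Nat.div_add_mod (N - r) q
    have hmod := Nat.mod_lt (N - r) hq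
    refine (hpk ((N - r) / q) N (by omega)).trans (mul_le_mul_of_nonneg_left ?_ zero_le_two)
    rw [← inv_pow, ← hpow, ← pow_mul, le_div_iff₀ hpos, ← pow_add]
    exact pow_le_pow_of_le_one h0.le h1.le (by omega)

theorem corollary1p3 {G : Type*} [Group G] [Countable G] [DecidableEq G]
    (F : ℕ → Finset G) (hF : IsLeftFolnerSeq F) (hT : IsStronglyTempered F)
    (α β S : ℝ) (hαβ : α < β) (hS : 0 < S) :
    ∃ c₀ c₁ : ℝ, 0 < c₀ ∧ c₀ < 1 ∧ 0 < c₁ ∧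
      ∀ (X : Type*) [MeasurableSpace X] [MulAction G X] (μ : Measure X) [IsProbabilityMeasure μ],
        (∀ g : G, MeasurePreserving (fun x : X => g • x) μ μ) →
        ∀ f : X → ℝ, MemLp f ∞ μ → eLpNorm f ∞ μ ≤ ENNReal.ofReal S →
          ∀ N : ℕ, μ.real (fluctuationSet F f α β N) ≤ c₁ * c₀ ^ N := by
  set K : ℝ := S + |α| + |β| with hKdef
  have hK : 0 < K := by positivity
  set γ : ℝ := (β - α) / K with hγdef
  have hγ : 0 < γ := div_pos (sub_pos.2 hαβ) hK
  have hγ' : γ ≤ 1 := by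
    rw [hγdef, div_le_one hK, hKdef]
    linarith [le_abs_self β, neg_abs_le α]
  have hγK : γ * K = β - α := div_mul_cancel₀ _ hK.ne'
  set ε : ℝ := γ / 100 with hεdef
  have hε0 : 0 < ε := by positivity
  have hε : 100 * ε = γ := by rw [hεdef]; ring
  obtain ⟨L, hL⟩ := exists_nat_ge ((ε ^ 2)⁻¹)
  have hL1 : 1 ≤ ε ^ 2 * L := by
    rwa [inv_le_iff_one_le_mul₀ (by positivity), mul_comm] at hL
  have hL0 : 0 < L := by
    rcases Nat.eq_zero_or_pos L with rfl | h
    · norm_num at hL1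
    · exact h
  obtain ⟨m, hm⟩ := hT (1 + ε) (by linarith)
  obtain ⟨a, ha⟩ := hF.1 m
  -- Right translation by `a⁻¹` puts `1` in `E 0` and keeps bi-temperedness; it only replaces the
  -- point `x` by `a • x`.
  set E : ℕ → Finset G := fun n => F (m + n) * {a⁻¹} with hEdef
  have hE : ∀ n, (E n).Nonempty := fun n => (hF.1 _).mul (Finset.singleton_nonempty _)
  have h1E : 1 ∈ E 0 :=
    Finset.mem_mul.2 ⟨a, ha, a⁻¹, Finset.mem_singleton_self _, mul_inv_cancel a⟩
  have hEt : IsBiTempered (1 + ε) E := hm.mul_singleton a⁻¹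
  -- The shift `m + 1` pays for the `m` fluctuations lost to the tail and the one dropped to make
  -- scales positive.
  obtain ⟨c₀, c₁, hc0, hc1, hc2, hc⟩ := exists_geometric_bound (lam := 1 + γ / 2) (by linarith)
    (q := 2 * L) (by omega) (m + 1)
  refine ⟨c₀, c₁, hc0, hc1, hc2, fun X _ _ μ _ hG f hf hfS => ?_⟩
  refine hc _ (fun N => measureReal_le_one) fun k N hN => ?_
  obtain ⟨f', hf'm, hf'S, hff'⟩ := exists_measurable_bounded_ae_eq hS.le hf.1 hfS
  rw [measureReal_congr (fluctuationSet_ae_eq hG hff' F α β N)]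
  have hbd : ∀ t y, |t| ≤ |α| + |β| → |f' y - t| ≤ K := fun t y ht => by
    linarith [abs_sub (f' y) t, hf'S y]
  have hEbound := measureReal_fluctuationSet_le_of_measurable hG (f := f') (k := k) (N := N - m)
    hF.exists_card_mul_le hE h1E hEt hγ hγ' hε hL1 hK hγK hf'm
    (fun y => by rw [abs_sub_comm]; exact hbd α y (by linarith [abs_nonneg β]))
    (fun y => hbd β y (by linarith [abs_nonneg α])) (by omega)
  have hsub : fluctuationSet F f' α β N ⊆
      (fun x : X => a • x) ⁻¹' fluctuationSet E f' α β (N - m) := by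
    intro x hx
    have h : Fluctuates (fun n => ergodicAverage (F n) f' x) α β (N - m + m) := by
      rwa [Nat.sub_add_cancel (by omega)]
    change Fluctuates (fun n => ergodicAverage (E n) f' (a • x)) α β (N - m)
    simpa only [hEdef, ergodicAverage_mul_singleton, inv_smul_smul] using h.tail
  refine (measureReal_mono hsub).trans ?_
  refine le_trans (le_of_eq ?_) hEbound
  have hmeas : MeasurableSet (fluctuationSet E f' α β (N - m)) := by
    rw [← iUnion_boundedFluctuationSet]
    exact MeasurableSet.iUnion fun M =>
      measurableSet_boundedFluctuationSet (fun g => (hG g).measurable) E hf'm α β _ M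
  rw [measureReal_def, (hG a).measure_preimage hmeas.nullMeasurableSet, measureReal_def]
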